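/- Let $\Phi_1$ (macro base stations) and $\Phi_2$ (small cell base stations) be independent homogeneous Poisson point processes on $\mathbb R^2$ with densities $\lambda_1,\lambda_2>0$. Stations of tier $k\in\{1,2\}$ transmit with power $P_k>0$, and a user at distance $r$ from such a station receives (mean) power $P_k r^{-\alpha}$, where $\alpha>2$. Let $r_c\ge 0$ be the charging range of the small cell stations, $\hat r_a\ge 0$ the maximum distance that a user is willing to move, and $r_s=r_c+\hat r_a$. Consider a user at a fixed location (for instance the origin), whose residual battery level is in $\{0,1,2,3\}$; it is a high-battery user if the level is $2$ or $3$, and a low-battery (battery-depleting) user if the level is $1$. A user of level $0$ or $1$ is attracted if the distance it would have to move straight towards its nearest small cell station in order to be within distance $r_c$ of it is at most $\hat r_a$; users of level $2$ or $3$ are never attracted. An attracted user associates with a small cell station (tier $2$); every other user associates with the station from which it receives the largest power. Then, for $k\in\{1,2\}$, the probability $\mathcal A_k^h$ that a high-battery user associates with tier $k$ and the probability $\mathcal A_k^\ell$ that a low-battery user associates with tier $k$ are $$\mathcal A_k^h=\Big[\lambda_k^{-1}\sum_{i=1}^2\lambda_i\Big(\frac{P_i}{P_k}\Big)^{2/\alpha}\Big]^{-1},$$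 $$\mathcal A_k^\ell=(-1)^k\Big(\mathcal A_2^h\, e^{-\pi\frac{\lambda_2}{\mathcal A_2^h}r_s^2}-e^{-\pi\lambda_2 r_s^2}\Big)+(k-1).$$ -/

import Mathlib

open MeasureTheory ProbabilityTheory
open scoped ENNReal NNReal

/-- The plane `ℝ²` with its Euclidean norm. -/
abbrev Plane : Type := EuclideanSpace ℝ (Fin 2)

/-- A bounded Borel subset of the plane. -/
abbrev BoundedBorel : Type := {B : Set Plane // MeasurableSet B ∧ Bornology.IsBounded B}

/-- The number of points of the random set `Φ` in `B`. -/
noncomputable def pointCount {Ω : Type*} (Φ : Ω → Set Plane) (B : Set Plane) (ω : Ω) : ℕ :=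
  (Φ ω ∩ B).ncard

/-- `Φ` is a homogeneous Poisson point process on the plane with density `lam`, given as a random
locally finite set of points. -/
structure IsHPPP {Ω : Type*} [MeasurableSpace Ω] (μ : Measure Ω) (lam : ℝ)
    (Φ : Ω → Set Plane) : Prop where
  /-- every bounded region contains finitely many points -/
  locallyFinite : ∀ (ω : Ω) (B : Set Plane), Bornology.IsBounded B → (Φ ω ∩ B).Finite
  /-- counts in bounded Borel sets are random variables -/
  measurable_count : ∀ B : BoundedBorel, Measurable (pointCount Φ B.1)
  /-- the count in `B` is Poisson with mean `lam * area B` -/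
  law_count : ∀ B : BoundedBorel,
    μ.map (pointCount Φ B.1) = poissonMeasure (lam * volume.real B.1).toNNReal
  /-- counts in pairwise disjoint bounded Borel sets are independent -/
  indep_count : ∀ (n : ℕ) (B : Fin n → BoundedBorel),
    Pairwise (fun i j => Disjoint (B i).1 (B j).1) →
      iIndepFun (fun i => pointCount Φ (B i).1) μ

/-- Two point processes are independent: their whole families of counts are. -/
def IndepPointProcesses {Ω : Type*} [MeasurableSpace Ω] (μ : Measure Ω)
    (Φ Ψ : Ω → Set Plane) : Prop :=
  IndepFun (fun ω (B : BoundedBorel) => pointCount Φ B.1 ω)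
    (fun ω (B : BoundedBorel) => pointCount Ψ B.1 ω) μ

/-- The tier number `1` (macro cells, index `0`) or `2` (small cells, index `1`). -/
def tierNumber (k : Fin 2) : ℕ := k.val + 1

/-- Mean power received at `u` from a station at `x` transmitting with power `p`, under path loss
with exponent `α` (infinite if the station is at `u`). -/
noncomputable def receivedPower (α p : ℝ) (u x : Plane) : ℝ≥0∞ :=
  ENNReal.ofReal p * edist u x ^ (-α)

/-- Among all base stations `S 0 ∪ S 1`, where those of tier `j` transmit with power `P j`, one of
tier `k` gives the strongest received power at `u`. -/
def StrongestFrom (P : Fin 2 → ℝ) (α : ℝ) (u : Plane) (S : Fin 2 → Set Plane) (k : Fin 2) : Prop :=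
  ∃ x ∈ S k, ∀ j, ∀ y ∈ S j, receivedPower α (P j) u y ≤ receivedPower α (P k) u x

/-- Residual battery energy, as the number `0, 1, 2, 3` of information receptions it allows. -/
abbrev BatteryLevel : Type := Fin 4

/-- High battery users: residual energy `2` or `3`. -/
def IsHighBattery (L : BatteryLevel) : Prop := L = 2 ∨ L = 3

/-- Low battery (battery depleting) users: residual energy `1`. -/
def IsLowBattery (L : BatteryLevel) : Prop := L = 1

/-- The distance a user at `u` has to move straight towards a small cell base station at `x` until
it is within the charging range `rc` (zero if it is already there). -/
noncomputable def attractionDistance (rc : ℝ) (u x : Plane) : ℝ := max (dist u x - rc) 0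

/-- A user at `u` with battery level `L` is spatially attracted: its battery level is `0` or `1`,
and the attraction distance to the nearest small cell base station is at most `raMax`. -/
def IsAttracted (rc raMax : ℝ) (L : BatteryLevel) (u : Plane) (small : Set Plane) : Prop :=
  (L = 0 ∨ L = 1) ∧
    ∃ x ∈ small, (∀ y ∈ small, dist u x ≤ dist u y) ∧ attractionDistance rc u x ≤ raMax

/-- The association rule: an attracted user associates with a small cell base station; every other
user associates with the base station giving the strongest received power. -/
def AssociatesWith (P : Fin 2 → ℝ) (α rc raMax : ℝ) (L : BatteryLevel) (u : Plane)
    (S : Fin 2 → Set Plane) (k : Fin 2) : Prop :=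
  (IsAttracted rc raMax L u (S 1) ∧ k = 1) ∨
    (¬ IsAttracted rc raMax L u (S 1) ∧ StrongestFrom P α u S k)

/-- The event that the user located at `u` with battery level `L` associates with tier `k`. -/
def associationEvent {Ω : Type*} (Φ : Fin 2 → Ω → Set Plane) (P : Fin 2 → ℝ) (α rc raMax : ℝ)
    (L : BatteryLevel) (u : Plane) (k : Fin 2) : Set Ω :=
  {ω | AssociatesWith P α rc raMax L u (fun j => Φ j ω) k}

/-- The closed form `[λₖ⁻¹ ∑ᵢ λᵢ (Pᵢ / Pₖ) ^ (2 / α)]⁻¹`. -/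
noncomputable def highFormula (lam P : Fin 2 → ℝ) (α : ℝ) (k : Fin 2) : ℝ :=
  ((lam k)⁻¹ * ∑ i, lam i * (P i / P k) ^ (2 / α))⁻¹

/-!
A station of tier `k` at distance `d` competes through `d ^ 2 / P k ^ (2 / α)`, the smallest value
giving the strongest signal. By the void probabilities of a Poisson process the minimum over tier
`k` is exponential with rate `π λₖ Pₖ ^ (2 / α)`, so a user that is not attracted sees a race
between two independent exponential clocks, tied with probability zero: a tier wins with
probability proportional to its rate and, independently of the winner, the winning time is
exponential with the sum of the rates. A low-battery user is attracted exactly when the nearest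
small cell is within `rc + raMax`, so it associates with a small cell either then, or when that
clock still rings first afterwards.
-/

section Exponential

open Set Filter Real

variable {a b r s : ℝ}

instance nullSingletonClass_expMeasure : NullSingletonClass (expMeasure r) :=
  inferInstanceAs (NullSingletonClass (volume.withDensity (exponentialPDF r)))

theorem expMeasure_Ioi (hr : 0 < r) {x : ℝ} (hx : 0 ≤ x) :
    expMeasure r (Ioi x) = ENNReal.ofReal (exp (-(r * x))) := by
  have := isProbabilityMeasure_expMeasure hr
  have hle : exp (-(r * x)) ≤ 1 := exp_le_one_iff.2 (by nlinarith)
  rw [← compl_Iic, prob_compl_eq_one_sub measurableSet_Iic, ← ofReal_cdf, cdf_expMeasure_eq hr,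
    if_pos hx, ← ENNReal.ofReal_one, ← ENNReal.ofReal_sub _ (by linarith), sub_sub_cancel]

theorem eq_expMeasure_of_measure_Ioi {ν : Measure ℝ} [IsProbabilityMeasure ν] (hr : 0 < r)
    (hν : ∀ t, 0 ≤ t → ν (Ioi t) = ENNReal.ofReal (exp (-(r * t)))) : ν = expMeasure r := by
  have := isProbabilityMeasure_expMeasure hr
  have hIic : ∀ t, 0 ≤ t → ν (Iic t) = expMeasure r (Iic t) := fun t ht => by
    rw [← compl_Ioi, prob_compl_eq_one_sub measurableSet_Ioi,
      prob_compl_eq_one_sub measurableSet_Ioi, hν t ht, expMeasure_Ioi hr ht]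
  have hzero : expMeasure r (Iic 0) = 0 := by
    rw [← ofReal_cdf, cdf_expMeasure_eq hr]
    simp
  refine Measure.ext_of_Iic _ _ fun t => (le_total 0 t).elim (hIic t) fun ht => ?_
  rw [measure_mono_null (Iic_subset_Iic.2 ht) hzero,
    measure_mono_null (Iic_subset_Iic.2 ht) ((hIic 0 le_rfl).trans hzero)]

theorem setLIntegral_exp_neg_expMeasure (ha : 0 ≤ a) (hab : 0 < a + b) {S : Set ℝ}
    (hS : MeasurableSet S) :
    ∫⁻ x in S, ENNReal.ofReal (exp (-(b * x))) ∂expMeasure a =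
      ENNReal.ofReal (a / (a + b)) * expMeasure (a + b) S := by
  have hm : ∀ c, Measurable (exponentialPDF c) := fun c =>
    (measurable_exponentialPDFReal c).ennreal_ofReal
  have htilt : ∀ x, exponentialPDF a x * ENNReal.ofReal (exp (-(b * x))) =
      ENNReal.ofReal (a / (a + b)) * exponentialPDF (a + b) x := fun x => by
    rcases lt_or_ge x 0 with hx | hx
    · simp only [exponentialPDF_of_neg hx, zero_mul, mul_zero]
    · rw [exponentialPDF_of_nonneg hx, exponentialPDF_of_nonneg hx,
        ← ENNReal.ofReal_mul (by positivity), ← ENNReal.ofReal_mul (by positivity), mul_assoc,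
        ← exp_add, ← mul_assoc, div_mul_cancel₀ _ hab.ne']
      ring_nf
  calc ∫⁻ x in S, ENNReal.ofReal (exp (-(b * x))) ∂expMeasure a
      = ∫⁻ x in S, exponentialPDF a x * ENNReal.ofReal (exp (-(b * x))) :=
        setLIntegral_withDensity_eq_setLIntegral_mul _ (hm a) (by fun_prop) hS
    _ = ENNReal.ofReal (a / (a + b)) * ∫⁻ x in S, exponentialPDF (a + b) x := by
        simp only [htilt, lintegral_const_mul _ (hm (a + b))]
    _ = ENNReal.ofReal (a / (a + b)) * expMeasure (a + b) S := by
        rw [← withDensity_apply _ hS]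
        rfl

theorem expMeasure_prod_lt_and_le (ha : 0 < a) (hb : 0 < b) (hs : 0 ≤ s) :
    (expMeasure a).prod (expMeasure b) {p | s < p.1 ∧ p.1 ≤ p.2} =
      ENNReal.ofReal (a / (a + b) * exp (-((a + b) * s))) := by
  have := isProbabilityMeasure_expMeasure hb
  have hm : MeasurableSet {p : ℝ × ℝ | s < p.1 ∧ p.1 ≤ p.2} :=
    (measurableSet_lt measurable_const measurable_fst).inter
      (measurableSet_le measurable_fst measurable_snd)
  have hslice : ∀ x, expMeasure b (Prod.mk x ⁻¹' {p | s < p.1 ∧ p.1 ≤ p.2}) =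
      (Ioi s).indicator (fun x => ENNReal.ofReal (exp (-(b * x)))) x := fun x => by
    by_cases hx : s < x
    · rw [indicator_of_mem (mem_Ioi.2 hx), ← expMeasure_Ioi hb (hs.trans hx.le),
        measure_congr Ioi_ae_eq_Ici]
      simp only [preimage_ofPred_eq, hx, true_and]
      rfl
    · simp [hx]
  rw [Measure.prod_apply hm, lintegral_congr hslice, lintegral_indicator measurableSet_Ioi,
    setLIntegral_exp_neg_expMeasure ha.le (by positivity) measurableSet_Ioi,
    expMeasure_Ioi (by positivity) hs, ← ENNReal.ofReal_mul (by positivity)]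

variable {Ω : Type*} [MeasurableSpace Ω] {μ : Measure Ω} {X Y : Ω → ℝ}

theorem measureReal_lt_and_le_of_hasLaw_expMeasure (ha : 0 < a) (hb : 0 < b) (hs : 0 ≤ s)
    (hX : HasLaw X (expMeasure a) μ) (hY : HasLaw Y (expMeasure b) μ) (hXY : IndepFun X Y μ) :
    μ.real {ω | s < X ω ∧ X ω ≤ Y ω} = a / (a + b) * exp (-((a + b) * s)) := by
  have := isProbabilityMeasure_expMeasure ha
  have := hX.isProbabilityMeasure
  have hm : MeasurableSet {p : ℝ × ℝ | s < p.1 ∧ p.1 ≤ p.2} :=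
    (measurableSet_lt measurable_const measurable_fst).inter
      (measurableSet_le measurable_fst measurable_snd)
  rw [(hXY.hasLaw_prod hX hY).measureReal_eq hm, measureReal_def,
    expMeasure_prod_lt_and_le ha hb hs, ENNReal.toReal_ofReal (by positivity)]

end Exponential

theorem ae_ne_of_indepFun {Ω β : Type*} [MeasurableSpace Ω] [MeasurableSpace β]
    [MeasurableEq β] {μ : Measure Ω} [IsFiniteMeasure μ] {X Y : Ω → β}
    (hX : AEMeasurable X μ) (hY : AEMeasurable Y μ) [NullSingletonClass (μ.map Y)]
    (hXY : IndepFun X Y μ) : ∀ᵐ ω ∂μ, X ω ≠ Y ω := by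
  have hdiag : (μ.map X).prod (μ.map Y) (Set.diagonal β) = 0 :=
    Measure.measure_prod_null_of_ae_null measurableSet_diagonal <| .of_forall fun x => by
      have : Prod.mk x ⁻¹' Set.diagonal β = {x} := Set.ext fun y => eq_comm
      simp only [this, measure_singleton, Pi.zero_apply]
  rw [← (indepFun_iff_map_prod_eq_prod_map_map hX hY).1 hXY] at hdiag
  exact ae_of_ae_map (hX.prodMk hY) (measure_eq_zero_iff_ae_notMem.1 hdiag)

section Nearest

open Set Metric

variable {X : Type*} [PseudoMetricSpace X] {S : Set X} {u : X}

theorem exists_mem_infEDist_eq_edist (hS : ∀ B, Bornology.IsBounded B → (S ∩ B).Finite)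
    (hne : S.Nonempty) (u : X) : ∃ x ∈ S, infEDist u S = edist u x := by
  obtain ⟨y, hy⟩ := hne
  obtain ⟨x, ⟨hxS, -⟩, hx⟩ := (hS _ (isBounded_closedBall (x := u) (r := dist y u))).isCompact
    |>.exists_infDist_eq_dist ⟨y, hy, mem_closedBall.2 le_rfl⟩ u
  rw [infDist_inter_closedBall_of_mem hy] at hx
  refine ⟨x, hxS, ?_⟩
  rw [edist_dist, ← hx, infDist, ENNReal.ofReal_toReal (infEDist_ne_top ⟨y, hy⟩)]

theorem ofReal_lt_infEDist_iff (hS : ∀ B, Bornology.IsBounded B → (S ∩ B).Finite) {r : ℝ}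
    (hr : 0 ≤ r) : ENNReal.ofReal r < infEDist u S ↔ Disjoint S (closedBall u r) := by
  refine ⟨fun h => ?_, fun h => ?_⟩
  · rw [← closedEBall_ofReal hr]
    exact (disjoint_closedEBall_of_lt_infEDist h).symm
  · rcases S.eq_empty_or_nonempty with rfl | hne
    · simp only [infEDist_empty, ENNReal.ofReal_lt_top]
    obtain ⟨x, hxS, hx⟩ := exists_mem_infEDist_eq_edist hS hne u
    have hxr : r < dist x u := not_le.1 fun hle => h.notMem_of_mem_left hxS hle
    rw [hx, edist_comm, edist_dist]
    exact (ENNReal.ofReal_lt_ofReal_iff_of_nonneg hr).2 hxr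

theorem sq_lt_infDist_sq_iff (hne : S.Nonempty) {r : ℝ} (hr : 0 ≤ r) :
    r ^ 2 < infDist u S ^ 2 ↔ ENNReal.ofReal r < infEDist u S := by
  rw [ENNReal.ofReal_lt_iff_lt_toReal hr (infEDist_ne_top hne), sq_lt_sq₀ hr infDist_nonneg,
    infDist]

end Nearest

section PoissonPointProcess

open Set Metric

variable {Ω : Type*} [MeasurableSpace Ω] {μ : Measure Ω} {lam : ℝ} {Φ Ψ : Ω → Set Plane}

namespace IsHPPP

theorem isProbabilityMeasure (hΦ : IsHPPP μ lam Φ) : IsProbabilityMeasure μ := by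
  have := hΦ.law_count ⟨∅, .empty, Bornology.isBounded_empty⟩
  have : IsProbabilityMeasure (μ.map (pointCount Φ ∅)) := by
    rw [this]
    infer_instance
  exact Measure.isProbabilityMeasure_of_map (pointCount Φ ∅)

theorem pointCount_eq_zero_iff (hΦ : IsHPPP μ lam Φ) (B : BoundedBorel) (ω : Ω) :
    pointCount Φ B.1 ω = 0 ↔ Disjoint (Φ ω) B.1 := by
  rw [disjoint_iff_inter_eq_empty]
  exact ncard_eq_zero (hΦ.locallyFinite ω B.1 B.2.2)

theorem measure_disjoint (hΦ : IsHPPP μ lam Φ) (hlam : 0 ≤ lam) (B : BoundedBorel) :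
    μ {ω | Disjoint (Φ ω) B.1} = ENNReal.ofReal (Real.exp (-(lam * volume.real B.1))) := by
  have hset : {ω | Disjoint (Φ ω) B.1} = pointCount Φ B.1 ⁻¹' {0} :=
    ext fun ω => (hΦ.pointCount_eq_zero_iff B ω).symm
  rw [hset, ← Measure.map_apply (hΦ.measurable_count B) (measurableSet_singleton 0),
    hΦ.law_count, poissonMeasure_singleton,
    Real.coe_toNNReal _ (mul_nonneg hlam measureReal_nonneg), pow_zero, mul_one,
    Nat.factorial_zero, Nat.cast_one, div_one]

theorem measure_ofReal_lt_infEDist (hΦ : IsHPPP μ lam Φ) (hlam : 0 ≤ lam) (u : Plane) {r : ℝ}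
    (hr : 0 ≤ r) :
    μ {ω | ENNReal.ofReal r < infEDist u (Φ ω)} =
      ENNReal.ofReal (Real.exp (-(Real.pi * lam * r ^ 2))) := by
  have hvol : volume.real (closedBall u r) = r ^ 2 * Real.pi := by
    rw [measureReal_def, EuclideanSpace.volume_closedBall_fin_two, ENNReal.toReal_mul,
      ENNReal.toReal_pow, ENNReal.toReal_ofReal hr,
      ENNReal.toReal_ofReal Real.pi_pos.le]
  simp only [ofReal_lt_infEDist_iff (hΦ.locallyFinite _) hr]
  rw [hΦ.measure_disjoint hlam ⟨_, measurableSet_closedBall, isBounded_closedBall⟩, hvol]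
  ring_nf

theorem ae_nonempty (hΦ : IsHPPP μ lam Φ) (hlam : 0 < lam) : ∀ᵐ ω ∂μ, (Φ ω).Nonempty := by
  have hle : ∀ n : ℕ, μ {ω | ¬ (Φ ω).Nonempty} ≤
      ENNReal.ofReal (Real.exp (-(Real.pi * lam * (n : ℝ) ^ 2))) := fun n => by
    rw [← hΦ.measure_ofReal_lt_infEDist hlam.le 0 n.cast_nonneg]
    refine measure_mono fun ω hω => ?_
    rw [mem_ofPred_eq, infEDist_eq_top_iff.2 (not_nonempty_iff_eq_empty.1 hω)]
    exact ENNReal.ofReal_lt_top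
  have hlim : Filter.Tendsto
      (fun n : ℕ => ENNReal.ofReal (Real.exp (-(Real.pi * lam * (n : ℝ) ^ 2))))
      Filter.atTop (nhds 0) := by
    rw [← ENNReal.ofReal_zero]
    refine ENNReal.tendsto_ofReal (Real.tendsto_exp_neg_atTop_nhds_zero.comp ?_)
    exact ((Filter.tendsto_pow_atTop two_ne_zero).comp
      tendsto_natCast_atTop_atTop).const_mul_atTop (mul_pos Real.pi_pos hlam)
  exact le_antisymm (ge_of_tendsto' hlim hle) bot_le

theorem comap_infEDist_le_comap_pointCount (hΦ : IsHPPP μ lam Φ) (u : Plane) :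
    MeasurableSpace.comap (fun ω => infEDist u (Φ ω)) inferInstance ≤
      MeasurableSpace.comap (fun ω (B : BoundedBorel) => pointCount Φ B.1 ω) inferInstance := by
  rw [← measurable_iff_comap_le]
  refine measurable_of_Ioi (mδ := _) fun r => ?_
  rcases eq_or_ne r ⊤ with rfl | hr
  · simp only [Ioi_top, preimage_empty, MeasurableSet.empty]
  lift r to ℝ≥0 using hr
  let B : BoundedBorel := ⟨closedBall u r, measurableSet_closedBall, isBounded_closedBall⟩
  refine ⟨_, measurable_pi_apply B (measurableSet_singleton 0), ext fun ω => ?_⟩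
  rw [← ENNReal.ofReal_coe_nnreal]
  exact (hΦ.pointCount_eq_zero_iff B ω).trans
    (ofReal_lt_infEDist_iff (hΦ.locallyFinite ω) r.coe_nonneg).symm

theorem measurable_infEDist (hΦ : IsHPPP μ lam Φ) (u : Plane) :
    Measurable fun ω => infEDist u (Φ ω) :=
  measurable_iff_comap_le.2 <| (hΦ.comap_infEDist_le_comap_pointCount u).trans
    (measurable_pi_lambda _ hΦ.measurable_count).comap_le

theorem hasLaw_infDist_sq_div (hΦ : IsHPPP μ lam Φ) (hlam : 0 < lam) (u : Plane) {w : ℝ}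
    (hw : 0 < w) :
    HasLaw (fun ω => infDist u (Φ ω) ^ 2 / w) (expMeasure (Real.pi * (lam * w))) μ := by
  have hm : Measurable fun ω => infDist u (Φ ω) ^ 2 / w :=
    ((hΦ.measurable_infEDist u).ennreal_toReal.pow_const 2).div_const w
  have := hΦ.isProbabilityMeasure
  have := Measure.isProbabilityMeasure_map (μ := μ) hm.aemeasurable
  refine ⟨hm.aemeasurable, eq_expMeasure_of_measure_Ioi (by positivity) fun t ht => ?_⟩
  have hr : √(t * w) ^ 2 = t * w := Real.sq_sqrt (by positivity)
  have hfar : (fun ω => infDist u (Φ ω) ^ 2 / w) ⁻¹' Ioi t =ᵐ[μ]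
      {ω | ENNReal.ofReal √(t * w) < infEDist u (Φ ω)} := by
    refine Filter.eventuallyEq_set.2 ?_
    filter_upwards [hΦ.ae_nonempty hlam] with ω hω
    rw [← sq_lt_infDist_sq_iff hω (Real.sqrt_nonneg _), hr]
    exact lt_div_iff₀ hw
  rw [Measure.map_apply hm measurableSet_Ioi, measure_congr hfar,
    hΦ.measure_ofReal_lt_infEDist hlam.le u (Real.sqrt_nonneg _), hr]
  ring_nf

theorem indepFun_infEDist {lam' : ℝ} (hΦ : IsHPPP μ lam Φ) (hΨ : IsHPPP μ lam' Ψ)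
    (hindep : IndepPointProcesses μ Φ Ψ) (u : Plane) :
    IndepFun (fun ω => infEDist u (Φ ω)) (fun ω => infEDist u (Ψ ω)) μ :=
  indep_of_indep_of_le_left (indep_of_indep_of_le_right hindep
    (hΨ.comap_infEDist_le_comap_pointCount u)) (hΦ.comap_infEDist_le_comap_pointCount u)

end IsHPPP

end PoissonPointProcess

section StrongestStation

open Set Metric

/-- The squared distance `d ^ 2` of a station transmitting with power `p`, weighted by
`p ^ (-(2 / α))`. With this normalization the received power is its `-(α / 2)`-th power for every
`p`, so the strongest station is the one minimizing it, whatever the tier. -/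
noncomputable def weightedSqDist (α p : ℝ) (d : ℝ≥0∞) : ℝ≥0∞ :=
  d ^ 2 / ENNReal.ofReal (p ^ (2 / α))

variable {α p : ℝ} {P : Fin 2 → ℝ} {u : Plane} {S : Fin 2 → Set Plane} {k : Fin 2}

theorem strictMono_weightedSqDist (α : ℝ) (hp : 0 < p) : StrictMono (weightedSqDist α p) :=
  fun _ _ h => ENNReal.div_lt_div_right
    (ENNReal.ofReal_ne_zero_iff.2 (Real.rpow_pos_of_pos hp _)) ENNReal.ofReal_ne_top
    (ENNReal.pow_lt_pow_left two_ne_zero h)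

theorem weightedSqDist_top (α p : ℝ) : weightedSqDist α p ⊤ = ⊤ := by
  rw [weightedSqDist, ENNReal.top_pow two_ne_zero, ENNReal.top_div_of_ne_top ENNReal.ofReal_ne_top]

theorem toReal_weightedSqDist (α : ℝ) (hp : 0 < p) (d : ℝ≥0∞) :
    (weightedSqDist α p d).toReal = d.toReal ^ 2 / p ^ (2 / α) := by
  rw [weightedSqDist, ENNReal.toReal_div, ENNReal.toReal_pow,
    ENNReal.toReal_ofReal (Real.rpow_nonneg hp.le _)]

theorem measurable_weightedSqDist (α p : ℝ) : Measurable (weightedSqDist α p) := by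
  unfold weightedSqDist
  fun_prop

theorem receivedPower_eq_weightedSqDist_rpow (hα : 0 < α) (hp : 0 < p) (u x : Plane) :
    receivedPower α p u x = weightedSqDist α p (edist u x) ^ (-(α / 2)) := by
  have hw : ENNReal.ofReal (p ^ (2 / α)) ≠ 0 :=
    ENNReal.ofReal_ne_zero_iff.2 (Real.rpow_pos_of_pos hp _)
  have hweight : ENNReal.ofReal (p ^ (2 / α)) ^ (α / 2) = ENNReal.ofReal p := by
    rw [ENNReal.ofReal_rpow_of_pos (by positivity), ← Real.rpow_mul hp.le,
      div_mul_div_cancel₀ hα.ne', div_self two_ne_zero, Real.rpow_one]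
  have hsq : (edist u x ^ 2) ^ (α / 2) = edist u x ^ α := by
    rw [← ENNReal.rpow_natCast, ← ENNReal.rpow_mul, Nat.cast_ofNat,
      mul_div_cancel₀ _ two_ne_zero]
  rw [weightedSqDist, ENNReal.rpow_neg, ← ENNReal.inv_rpow,
    ENNReal.inv_div (.inl ENNReal.ofReal_ne_top) (.inl hw),
    ENNReal.div_rpow_of_nonneg _ _ (by positivity), hweight, hsq, div_eq_mul_inv,
    ← ENNReal.rpow_neg, receivedPower]

theorem receivedPower_le_receivedPower_iff (hα : 0 < α) {q : ℝ} (hp : 0 < p) (hq : 0 < q)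
    {x y : Plane} : receivedPower α q u y ≤ receivedPower α p u x ↔
      weightedSqDist α p (edist u x) ≤ weightedSqDist α q (edist u y) := by
  rw [receivedPower_eq_weightedSqDist_rpow hα hp, receivedPower_eq_weightedSqDist_rpow hα hq,
    ENNReal.rpow_neg, ENNReal.rpow_neg, ENNReal.inv_le_inv,
    ENNReal.rpow_le_rpow_iff (half_pos hα)]

theorem strongestFrom_iff (hα : 0 < α) (hP : ∀ j, 0 < P j)
    (hS : ∀ j B, Bornology.IsBounded B → (S j ∩ B).Finite) :
    StrongestFrom P α u S k ↔ infEDist u (S k) ≠ ⊤ ∧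
      ∀ j, weightedSqDist α (P k) (infEDist u (S k)) ≤
        weightedSqDist α (P j) (infEDist u (S j)) := by
  have hmono := fun j => (strictMono_weightedSqDist α (hP j)).monotone
  simp only [StrongestFrom, receivedPower_le_receivedPower_iff hα (hP _) (hP _)]
  refine ⟨fun ⟨x, hx, hle⟩ => ⟨infEDist_ne_top ⟨x, hx⟩, fun j => ?_⟩, fun ⟨htop, hle⟩ => ?_⟩
  · rcases (S j).eq_empty_or_nonempty with hj | hj
    · rw [hj, infEDist_empty, weightedSqDist_top]
      exact le_top
    · obtain ⟨y, hy, hyj⟩ := exists_mem_infEDist_eq_edist (hS j) hj u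
      rw [hyj]
      exact (hmono k (infEDist_le_edist_of_mem hx)).trans (hle j y hy)
  · obtain ⟨x, hx, hxk⟩ := exists_mem_infEDist_eq_edist (hS k)
      (nonempty_iff_ne_empty.2 (mt infEDist_eq_top_iff.2 htop)) u
    exact ⟨x, hx, fun j y hy => hxk ▸ (hle j).trans (hmono j (infEDist_le_edist_of_mem hy))⟩

theorem strongestFrom_iff_infDist (hα : 0 < α) (hP : ∀ j, 0 < P j)
    (hS : ∀ j B, Bornology.IsBounded B → (S j ∩ B).Finite) (hne : ∀ j, (S j).Nonempty) :
    StrongestFrom P α u S k ↔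
      ∀ j, infDist u (S k) ^ 2 / P k ^ (2 / α) ≤ infDist u (S j) ^ 2 / P j ^ (2 / α) := by
  have hfin : ∀ j, weightedSqDist α (P j) (infEDist u (S j)) ≠ ⊤ := fun j => by
    rw [← weightedSqDist_top α (P j)]
    exact (strictMono_weightedSqDist α (hP j)).injective.ne (infEDist_ne_top (hne j))
  rw [strongestFrom_iff hα hP hS, and_iff_right (infEDist_ne_top (hne k))]
  refine forall_congr' fun j => ?_
  rw [← ENNReal.toReal_le_toReal (hfin k) (hfin j), toReal_weightedSqDist α (hP k),
    toReal_weightedSqDist α (hP j)]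
  rfl

end StrongestStation

theorem isAttracted_iff {S : Set Plane} (hS : ∀ B, Bornology.IsBounded B → (S ∩ B).Finite)
    {rc raMax : ℝ} (hra : 0 ≤ raMax) (hrs : 0 ≤ rc + raMax) {L : BatteryLevel} {u : Plane} :
    IsAttracted rc raMax L u S ↔
      (L = 0 ∨ L = 1) ∧ Metric.infEDist u S ≤ ENNReal.ofReal (rc + raMax) := by
  have hdist : ∀ x, attractionDistance rc u x ≤ raMax ↔
      edist u x ≤ ENNReal.ofReal (rc + raMax) := fun x => by
    rw [attractionDistance, max_le_iff, edist_dist, ENNReal.ofReal_le_ofReal_iff hrs,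
      and_iff_left hra, sub_le_iff_le_add']
  refine and_congr_right fun _ => ⟨fun ⟨x, hx, _, hle⟩ => ?_, fun h => ?_⟩
  · exact (Metric.infEDist_le_edist_of_mem hx).trans ((hdist x).1 hle)
  · have hne : S.Nonempty := Set.nonempty_iff_ne_empty.2 fun hempty =>
      (h.trans_lt ENNReal.ofReal_lt_top).ne (Metric.infEDist_eq_top_iff.2 hempty)
    obtain ⟨x, hx, hnear⟩ := exists_mem_infEDist_eq_edist hS hne u
    refine ⟨x, hx, fun y hy => ?_, (hdist x).2 (hnear ▸ h)⟩
    rw [← ENNReal.ofReal_le_ofReal_iff dist_nonneg, ← edist_dist, ← edist_dist, ← hnear]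
    exact Metric.infEDist_le_edist_of_mem hy

theorem associatesWith_iff_of_isHighBattery {L : BatteryLevel} (hL : IsHighBattery L)
    (P : Fin 2 → ℝ) (α rc raMax : ℝ) (u : Plane) (S : Fin 2 → Set Plane) (k : Fin 2) :
    AssociatesWith P α rc raMax L u S k ↔ StrongestFrom P α u S k := by
  have hattr : ¬ IsAttracted rc raMax L u (S 1) := by
    rcases hL with rfl | rfl <;> exact fun h => absurd h.1 (by decide)
  simp only [AssociatesWith, hattr, false_and, not_false_eq_true, true_and, false_or]

section HighFormula

variable {lam P : Fin 2 → ℝ} {α : ℝ}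

theorem highFormula_eq_div_sum (hP : ∀ k, 0 < P k) (lam : Fin 2 → ℝ) (α : ℝ) (k : Fin 2) :
    highFormula lam P α k = lam k * P k ^ (2 / α) / ∑ i, lam i * P i ^ (2 / α) := by
  have hsum : ∑ i, lam i * (P i / P k) ^ (2 / α) =
      (∑ i, lam i * P i ^ (2 / α)) / P k ^ (2 / α) := by
    rw [Finset.sum_div]
    refine Finset.sum_congr rfl fun i _ => ?_
    rw [Real.div_rpow (hP i).le (hP k).le, mul_div_assoc]
  rw [highFormula, hsum, mul_inv, inv_inv, inv_div, mul_div_assoc]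

theorem sum_highFormula (hlam : ∀ k, 0 < lam k) (hP : ∀ k, 0 < P k) (α : ℝ) :
    ∑ k, highFormula lam P α k = 1 := by
  simp only [highFormula_eq_div_sum hP, ← Finset.sum_div]
  exact div_self (Finset.sum_pos (fun i _ => mul_pos (hlam i) (Real.rpow_pos_of_pos (hP i) _))
    Finset.univ_nonempty).ne'

end HighFormula

section Association

open Set Metric

variable {Ω : Type*} [MeasurableSpace Ω] {μ : Measure Ω} {lam P : Fin 2 → ℝ} {α : ℝ}
  {Φ : Fin 2 → Ω → Set Plane}

theorem measurableSet_strongestFrom (hP : ∀ k, 0 < P k) (hα : 0 < α)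
    (hΦ : ∀ k, IsHPPP μ (lam k) (Φ k)) (u : Plane) (k : Fin 2) :
    MeasurableSet {ω | StrongestFrom P α u (fun j => Φ j ω) k} := by
  have hm := fun j => (hΦ j).measurable_infEDist u
  have hmw := fun j => (measurable_weightedSqDist α (P j)).comp (hm j)
  simp only [strongestFrom_iff hα hP fun j => (hΦ j).locallyFinite _, ofPred_and, ofPred_forall]
  exact (hm k (measurableSet_singleton ⊤).compl).inter
    (.iInter fun j => measurableSet_le (hmw k) (hmw j))

theorem ae_strongestFrom_iff (hlam : ∀ k, 0 < lam k) (hP : ∀ k, 0 < P k) (hα : 0 < α)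
    (hΦ : ∀ k, IsHPPP μ (lam k) (Φ k)) (u : Plane) :
    ∀ᵐ ω ∂μ, ∀ k, StrongestFrom P α u (fun j => Φ j ω) k ↔
      ∀ j, infDist u (Φ k ω) ^ 2 / P k ^ (2 / α) ≤ infDist u (Φ j ω) ^ 2 / P j ^ (2 / α) := by
  filter_upwards [ae_all_iff.2 fun k => (hΦ k).ae_nonempty (hlam k)] with ω hne k
  exact strongestFrom_iff_infDist hα hP (fun j => (hΦ j).locallyFinite ω) hne

theorem indepFun_infDist_sq_div (hΦ : ∀ k, IsHPPP μ (lam k) (Φ k)) {i j : Fin 2}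
    (hindep : IndepPointProcesses μ (Φ i) (Φ j)) (u : Plane) (w : Fin 2 → ℝ) :
    IndepFun (fun ω => infDist u (Φ i ω) ^ 2 / w i) (fun ω => infDist u (Φ j ω) ^ 2 / w j) μ :=
  ((hΦ i).indepFun_infEDist (hΦ j) hindep u).comp
    ((measurable_id.ennreal_toReal.pow_const 2).div_const (w i))
    ((measurable_id.ennreal_toReal.pow_const 2).div_const (w j))

theorem ae_strongestFrom_zero_iff_not_one (hlam : ∀ k, 0 < lam k) (hP : ∀ k, 0 < P k)
    (hα : 0 < α) (hΦ : ∀ k, IsHPPP μ (lam k) (Φ k))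
    (hindep : IndepPointProcesses μ (Φ 0) (Φ 1)) (u : Plane) :
    ∀ᵐ ω ∂μ, StrongestFrom P α u (fun j => Φ j ω) 0 ↔
      ¬ StrongestFrom P α u (fun j => Φ j ω) 1 := by
  have hlaw := fun k => (hΦ k).hasLaw_infDist_sq_div (hlam k) u
    (Real.rpow_pos_of_pos (hP k) (2 / α))
  have := (hΦ 0).isProbabilityMeasure
  have : NullSingletonClass (μ.map fun ω => infDist u (Φ 1 ω) ^ 2 / P 1 ^ (2 / α)) := by
    rw [(hlaw 1).map_eq]
    infer_instance
  filter_upwards [ae_strongestFrom_iff hlam hP hα hΦ u, ae_ne_of_indepFun (hlaw 0).aemeasurable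
    (hlaw 1).aemeasurable (indepFun_infDist_sq_div hΦ hindep u fun k => P k ^ (2 / α))]
    with ω hiff hne
  simp only [hiff, Fin.forall_fin_two, le_refl, true_and, and_true, not_le]
  exact hne.le_iff_lt

theorem measureReal_far_and_strongestFrom_one (hlam : ∀ k, 0 < lam k) (hP : ∀ k, 0 < P k)
    (hα : 0 < α) (hΦ : ∀ k, IsHPPP μ (lam k) (Φ k)) (hindep : IndepPointProcesses μ (Φ 0) (Φ 1))
    (u : Plane) {r : ℝ} (hr : 0 ≤ r) :
    μ.real {ω | ENNReal.ofReal r < infEDist u (Φ 1 ω) ∧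
        StrongestFrom P α u (fun j => Φ j ω) 1} =
      highFormula lam P α 1 *
        Real.exp (-(Real.pi * (lam 1 / highFormula lam P α 1) * r ^ 2)) := by
  set w : Fin 2 → ℝ := fun k => P k ^ (2 / α)
  have hw : ∀ k, 0 < w k := fun k => Real.rpow_pos_of_pos (hP k) _
  have hlw : ∀ k, 0 < lam k * w k := fun k => mul_pos (hlam k) (hw k)
  have hlaw := fun k => (hΦ k).hasLaw_infDist_sq_div (hlam k) u (hw k)
  have hevent : {ω | ENNReal.ofReal r < infEDist u (Φ 1 ω) ∧
        StrongestFrom P α u (fun j => Φ j ω) 1} =ᵐ[μ]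
      {ω | r ^ 2 / w 1 < infDist u (Φ 1 ω) ^ 2 / w 1 ∧
        infDist u (Φ 1 ω) ^ 2 / w 1 ≤ infDist u (Φ 0 ω) ^ 2 / w 0} := by
    refine Filter.eventuallyEq_set.2 ?_
    filter_upwards [ae_strongestFrom_iff hlam hP hα hΦ u, (hΦ 1).ae_nonempty (hlam 1)]
      with ω hiff hne
    rw [hiff, Fin.forall_fin_two, and_iff_left le_rfl, div_lt_div_iff_of_pos_right (hw 1),
      sq_lt_infDist_sq_iff hne hr]
  have hformula : highFormula lam P α 1 = lam 1 * w 1 / (lam 1 * w 1 + lam 0 * w 0) := by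
    rw [highFormula_eq_div_sum hP, Fin.sum_univ_two, add_comm]
  rw [measureReal_congr hevent,
    measureReal_lt_and_le_of_hasLaw_expMeasure (mul_pos Real.pi_pos (hlw 1))
      (mul_pos Real.pi_pos (hlw 0)) (div_nonneg (sq_nonneg r) (hw 1).le) (hlaw 1) (hlaw 0)
      (indepFun_infDist_sq_div hΦ hindep.symm u w), ← mul_add,
    mul_div_mul_left _ _ Real.pi_ne_zero, hformula]
  congr 2
  have := (hlam 1).ne'
  have := (hw 1).ne'
  field_simp

theorem measureReal_strongestFrom (hlam : ∀ k, 0 < lam k) (hP : ∀ k, 0 < P k) (hα : 0 < α)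
    (hΦ : ∀ k, IsHPPP μ (lam k) (Φ k)) (hindep : IndepPointProcesses μ (Φ 0) (Φ 1)) (u : Plane)
    (k : Fin 2) : μ.real {ω | StrongestFrom P α u (fun j => Φ j ω) k} = highFormula lam P α k := by
  have := (hΦ 1).isProbabilityMeasure
  have hpos : ∀ᵐ ω ∂μ, ENNReal.ofReal 0 < infEDist u (Φ 1 ω) := by
    refine (mem_ae_iff_prob_eq_one
      (measurableSet_lt measurable_const ((hΦ 1).measurable_infEDist u))).2 ?_
    rw [(hΦ 1).measure_ofReal_lt_infEDist (hlam 1).le u le_rfl, zero_pow two_ne_zero, mul_zero,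
      neg_zero, Real.exp_zero, ENNReal.ofReal_one]
  have hone : μ.real {ω | StrongestFrom P α u (fun j => Φ j ω) 1} = highFormula lam P α 1 := by
    have h := measureReal_far_and_strongestFrom_one hlam hP hα hΦ hindep u le_rfl
    rw [zero_pow two_ne_zero, mul_zero, neg_zero, Real.exp_zero, mul_one] at h
    rw [← h]
    refine measureReal_congr (Filter.eventuallyEq_set.2 ?_)
    filter_upwards [hpos] with ω hω
    exact (and_iff_right hω).symm
  match k with
  | 0 =>
    have hsum := sum_highFormula hlam hP α
    rw [Fin.sum_univ_two] at hsum
    rw [eq_sub_of_add_eq hsum, ← hone,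
      ← probReal_compl_eq_one_sub (measurableSet_strongestFrom hP hα hΦ u 1)]
    exact measureReal_congr (Filter.eventuallyEq_set.2
      (ae_strongestFrom_zero_iff_not_one hlam hP hα hΦ hindep u))
  | 1 => exact hone

variable {rc raMax : ℝ}

theorem measurableSet_isAttracted {lam : ℝ} {Φ : Ω → Set Plane} (hΦ : IsHPPP μ lam Φ)
    (hra : 0 ≤ raMax) (hrs : 0 ≤ rc + raMax) (L : BatteryLevel) (u : Plane) :
    MeasurableSet {ω | IsAttracted rc raMax L u (Φ ω)} := by
  simp only [isAttracted_iff (hΦ.locallyFinite _) hra hrs, ofPred_and]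
  exact (MeasurableSet.const _).inter
    (measurableSet_le (hΦ.measurable_infEDist u) measurable_const)

theorem measurableSet_associationEvent (hP : ∀ k, 0 < P k) (hα : 0 < α) (hra : 0 ≤ raMax)
    (hrs : 0 ≤ rc + raMax) (hΦ : ∀ k, IsHPPP μ (lam k) (Φ k)) (L : BatteryLevel) (u : Plane)
    (k : Fin 2) : MeasurableSet (associationEvent Φ P α rc raMax L u k) := by
  have hattr := measurableSet_isAttracted (hΦ 1) hra hrs L u
  exact (hattr.inter (.const _)).union
    (hattr.compl.inter (measurableSet_strongestFrom hP hα hΦ u k))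

theorem measureReal_associationEvent_zero (hlam : ∀ k, 0 < lam k) (hP : ∀ k, 0 < P k)
    (hα : 0 < α) (hra : 0 ≤ raMax) (hrs : 0 ≤ rc + raMax) (hΦ : ∀ k, IsHPPP μ (lam k) (Φ k))
    (hindep : IndepPointProcesses μ (Φ 0) (Φ 1)) (L : BatteryLevel) (u : Plane) :
    μ.real (associationEvent Φ P α rc raMax L u 0) =
      1 - μ.real (associationEvent Φ P α rc raMax L u 1) := by
  have := (hΦ 0).isProbabilityMeasure
  rw [← probReal_compl_eq_one_sub (measurableSet_associationEvent hP hα hra hrs hΦ L u 1)]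
  refine measureReal_congr (Filter.eventuallyEq_set.2 ?_)
  filter_upwards [ae_strongestFrom_zero_iff_not_one hlam hP hα hΦ hindep u] with ω hω
  simp only [associationEvent, AssociatesWith, mem_ofPred_eq, mem_compl_iff, hω, zero_ne_one,
    and_false, false_or, and_true]
  tauto

theorem measureReal_associationEvent_one_of_eq_zero_or_one (hlam : ∀ k, 0 < lam k)
    (hP : ∀ k, 0 < P k) (hα : 0 < α) (hra : 0 ≤ raMax) (hrs : 0 ≤ rc + raMax)
    (hΦ : ∀ k, IsHPPP μ (lam k) (Φ k)) (hindep : IndepPointProcesses μ (Φ 0) (Φ 1))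
    {L : BatteryLevel} (hL : L = 0 ∨ L = 1) (u : Plane) :
    μ.real (associationEvent Φ P α rc raMax L u 1) =
      highFormula lam P α 1 *
          Real.exp (-(Real.pi * (lam 1 / highFormula lam P α 1) * (rc + raMax) ^ 2)) -
        Real.exp (-(Real.pi * lam 1 * (rc + raMax) ^ 2)) + 1 := by
  have := (hΦ 1).isProbabilityMeasure
  set far := {ω | ENNReal.ofReal (rc + raMax) < infEDist u (Φ 1 ω)}
  have hfarm : MeasurableSet far := measurableSet_lt measurable_const ((hΦ 1).measurable_infEDist u)
  have hfar : μ.real far = Real.exp (-(Real.pi * lam 1 * (rc + raMax) ^ 2)) := by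
    rw [measureReal_def, (hΦ 1).measure_ofReal_lt_infEDist (hlam 1).le u hrs,
      ENNReal.toReal_ofReal (Real.exp_pos _).le]
  have hsplit : associationEvent Φ P α rc raMax L u 1 =
      farᶜ ∪ far ∩ {ω | StrongestFrom P α u (fun j => Φ j ω) 1} := by
    ext ω
    simp only [associationEvent, AssociatesWith, mem_ofPred_eq,
      isAttracted_iff ((hΦ 1).locallyFinite ω) hra hrs, hL, true_and, and_true, not_le]
    rw [← not_lt]
    rfl
  rw [hsplit, measureReal_union (disjoint_compl_left.mono_right inter_subset_left)
    (hfarm.inter (measurableSet_strongestFrom hP hα hΦ u 1)), probReal_compl_eq_one_sub hfarm,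
    hfar, ← measureReal_far_and_strongestFrom_one hlam hP hα hΦ hindep u hrs, ofPred_and]
  ring

end Association

theorem lemma1_general {Ω : Type*} [MeasurableSpace Ω] (μ : Measure Ω)
    (lam P : Fin 2 → ℝ) (hlam : ∀ k, 0 < lam k) (hP : ∀ k, 0 < P k)
    (α : ℝ) (hα : 0 < α) (rc raMax : ℝ) (hra : 0 ≤ raMax) (hrs : 0 ≤ rc + raMax)
    (Φ : Fin 2 → Ω → Set Plane) (hΦ : ∀ k, IsHPPP μ (lam k) (Φ k))
    (hindep : IndepPointProcesses μ (Φ 0) (Φ 1))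
    (u : Plane) (k : Fin 2) :
    (∀ L : BatteryLevel, IsHighBattery L →
      MeasurableSet (associationEvent Φ P α rc raMax L u k) ∧
      μ.real (associationEvent Φ P α rc raMax L u k) = highFormula lam P α k) ∧
    (∀ L : BatteryLevel, L = 0 ∨ L = 1 →
      MeasurableSet (associationEvent Φ P α rc raMax L u k) ∧
      μ.real (associationEvent Φ P α rc raMax L u k) =
        (-1) ^ tierNumber k *
            (highFormula lam P α 1 *
                Real.exp (-(Real.pi * (lam 1 / highFormula lam P α 1) * (rc + raMax) ^ 2)) -
              Real.exp (-(Real.pi * lam 1 * (rc + raMax) ^ 2))) +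
          ((tierNumber k : ℝ) - 1)) := by
  have hmeas := fun L => measurableSet_associationEvent hP hα hra hrs hΦ L u k
  refine ⟨fun L hL => ⟨hmeas L, ?_⟩, fun L hL => ⟨hmeas L, ?_⟩⟩
  · simp only [associationEvent, associatesWith_iff_of_isHighBattery hL]
    exact measureReal_strongestFrom hlam hP hα hΦ hindep u k
  have hone := measureReal_associationEvent_one_of_eq_zero_or_one hlam hP hα hra hrs hΦ hindep hL u
  have hzero := measureReal_associationEvent_zero hlam hP hα hra hrs hΦ hindep L u
  rw [hone] at hzero
  match k with
  | 0 => rw [hzero, tierNumber]; norm_num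
  | 1 => rw [hone, tierNumber]; norm_num

theorem lemma1 {Ω : Type*} [MeasurableSpace Ω] (μ : Measure Ω) [IsProbabilityMeasure μ]
    (lam P : Fin 2 → ℝ) (hlam : ∀ k, 0 < lam k) (hP : ∀ k, 0 < P k)
    (α : ℝ) (hα : 2 < α) (rc raMax : ℝ) (hrc : 0 ≤ rc) (hra : 0 ≤ raMax)
    (Φ : Fin 2 → Ω → Set Plane) (hΦ : ∀ k, IsHPPP μ (lam k) (Φ k))
    (hindep : IndepPointProcesses μ (Φ 0) (Φ 1))
    (u : Plane) (k : Fin 2) :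
    (∀ L : BatteryLevel, IsHighBattery L →
      MeasurableSet (associationEvent Φ P α rc raMax L u k) ∧
      μ.real (associationEvent Φ P α rc raMax L u k) = highFormula lam P α k) ∧
    (∀ L : BatteryLevel, IsLowBattery L → ∀ rs : ℝ, rs = rc + raMax →
      MeasurableSet (associationEvent Φ P α rc raMax L u k) ∧
      μ.real (associationEvent Φ P α rc raMax L u k) =
        (-1) ^ tierNumber k *
            (highFormula lam P α 1 *
                Real.exp (-(Real.pi * (lam 1 / highFormula lam P α 1) * rs ^ 2)) -
              Real.exp (-(Real.pi * lam 1 * rs ^ 2))) +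
          ((tierNumber k : ℝ) - 1)) := by
  obtain ⟨hhigh, hlow⟩ := lemma1_general μ lam P hlam hP α (by linarith) rc raMax hra
    (add_nonneg hrc hra) Φ hΦ hindep u k
  exact ⟨hhigh, fun L hL rs hrs => hrs ▸ hlow L (.inr hL)⟩
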